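/- A pointed frame is a frame $L$ with a frame homomorphism $*_L\colon L\to 2=\{\bot,\top\}$; a pointed frame homomorphism $f\colon L\to M$ is a frame homomorphism with $*_M\circ f=*_L$. Let $\mathcal{O}_*\mathbb{R}$ and $\mathcal{O}_*\overline{\mathbb{R}}$ be the frames of open subsets of $\mathbb{R}$ and of $\overline{\mathbb{R}}=[-\infty,\infty]$, each pointed at $0$ (that is, $*(U)=\top$ iff $0\in U$), and let $p\colon\mathcal{O}_*\overline{\mathbb{R}}\to\mathcal{O}_*\mathbb{R}$ be $U\mapsto U\cap\mathbb{R}$. For a pointed frame $L$, let $\mathcal{R}_0L$ be the set of pointed frame homomorphisms $\mathcal{O}_*\mathbb{R}\to L$, ordered by $f\le g$ iff $f(r,\infty)\le g(r,\infty)$ for all $r\in\mathbb{R}$, and let $\mathcal{R}_0^+L=\{h\in\mathcal{R}_0L : h\ge 0\}$, where $0(U)=\top$ if $0\in U$ and $0(U)=\bot$ otherwise. A continuous $w\colon\mathbb{R}\to\mathbb{R}$ with $w(0)=0$ acts on $\mathcal{R}_0L$ by $w(f)(V)=\bigvee\{f(U) : U \text{ open},\ w(U)\subseteq V\}=f(w^{-1}(V))$;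 scalar multiplication by $r$ is induced by $x\mapsto rx$ and the truncation $f\mapsto\overline{f}$ on $\mathcal{R}_0^+L$ by $x\mapsto\min(x,1)$. For $h\in\mathcal{R}_0^+L$ and an integer $n\ge1$, the $n$th truncation is $h\wedge n=n\,\overline{h/n}$. For a pointed frame $M$, let $\mathcal{D}_0M$ be the set of pointed frame homomorphisms $h'\colon\mathcal{O}_*\overline{\mathbb{R}}\to M$ such that $h'(-\infty,\infty)$ is dense in $M$ (the only element of $M$ disjoint from it is $\bot$). Let $q\colon M\to L$ be a compactification, i.e., a surjective pointed frame homomorphism with compact domain $M$ which is dense ($q(x)=\bot$ implies $x=\bot$), and let $$\mathcal{E}_0q=\{h\in\mathcal{R}_0L : \exists\, h'\in\mathcal{D}_0M\ (q\circ h'=h\circ p)\}.$$ Then an element $h\in\mathcal{R}_0^+L$ lies in $\mathcal{E}_0q$ if and only if for every integer $n\ge1$ the truncation $h\wedge n$ factors through $q$, i.e., $h\wedge n=q\circ\hat h_n$ for some $\hat h_n\in\mathcal{R}_0M$. -/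

import Mathlib

open TopologicalSpace

/-- A point of a frame `L`: a frame homomorphism from `L` to the two-element frame
(which is `Prop`, ordered by implication). A frame with such a point is a *pointed frame*. -/
class FramePoint (L : Type*) [Order.Frame L] where
  /-- The designated point. -/
  pt : FrameHom L Prop

/-- The frame homomorphism `U ↦ (x ∈ U)` of the insertion of the point `x` into a space. -/
def opensPoint {X : Type*} [TopologicalSpace X] (x : X) : FrameHom (Opens X) Prop where
  toFun U := x ∈ U
  map_inf' U V := by simp
  map_top' := by simp
  map_sSup' S := by
    simp only [Opens.mem_sSup, sSup_image, iSup_Prop_eq, exists_prop]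

/-- The pointed frame of open sets of a space pointed at `0`. It is used for the real line and for
the extended real line `[-∞, ∞]`. -/
instance {X : Type*} [TopologicalSpace X] [Zero X] : FramePoint (Opens X) := ⟨opensPoint 0⟩

/-- A pointed frame homomorphism: a frame homomorphism that commutes with the points. -/
@[ext]
structure PointedFrameHom (L M : Type*) [Order.Frame L] [FramePoint L]
    [Order.Frame M] [FramePoint M] where
  /-- The underlying frame homomorphism. -/
  hom : FrameHom L M
  /-- It commutes with the points. -/
  pt_comp : (FramePoint.pt : FrameHom M Prop).comp hom = FramePoint.pt

namespace PointedFrameHom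

variable {L M N : Type*} [Order.Frame L] [FramePoint L] [Order.Frame M] [FramePoint M]
  [Order.Frame N] [FramePoint N]

/-- Composition of pointed frame homomorphisms. -/
def comp (g : PointedFrameHom M N) (f : PointedFrameHom L M) : PointedFrameHom L N where
  hom := g.hom.comp f.hom
  pt_comp := by
    rw [← FrameHom.comp_assoc, g.pt_comp, f.pt_comp]

end PointedFrameHom

/-- A continuous function between spaces that carries `0` to `0` gives a pointed frame
homomorphism `U ↦ w ⁻¹ U` of the frames of open sets. -/
def pointedComap {X Y : Type*} [TopologicalSpace X] [Zero X] [TopologicalSpace Y] [Zero Y]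
    (w : C(X, Y)) (hw : w 0 = 0) : PointedFrameHom (Opens Y) (Opens X) where
  hom := Opens.comap w
  pt_comp := by
    ext U
    change w 0 ∈ U ↔ 0 ∈ U
    rw [hw]

/-- The pointed frame homomorphism `U ↦ U ∩ (-∞, ∞)` of the inclusion of `ℝ` in `[-∞, ∞]`. -/
noncomputable def inclReal : PointedFrameHom (Opens EReal) (Opens ℝ) :=
  pointedComap ⟨Real.toEReal, continuous_coe_real_ereal⟩ EReal.coe_zero

/-- `ℛ₀ L`: the pointed frame homomorphisms from the pointed frame of the reals to `L`. -/
abbrev RZero (L : Type*) [Order.Frame L] [FramePoint L] : Type _ :=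
  PointedFrameHom (Opens ℝ) L

namespace RZero

variable {L : Type*} [Order.Frame L] [FramePoint L]

/-- The unary operation on `ℛ₀ L` induced by a continuous `w : ℝ → ℝ` with `w 0 = 0`. It sends
`f` to `V ↦ f (w ⁻¹ V)`, which is the join of the `f U` over the open `U` with `w(U) ⊆ V`. -/
def induced (w : C(ℝ, ℝ)) (hw : w 0 = 0) (f : RZero L) : RZero L :=
  f.comp (pointedComap w hw)

/-- The zero element, induced by the function which is constantly `0`. It sends `V` to the top
if `0 ∈ V` and to the bottom otherwise. -/
instance : Zero (RZero L) where
  zero :=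
    { hom :=
        { toFun := fun V => ⨆ _ : (0 : ℝ) ∈ V, (⊤ : L)
          map_inf' := fun U V => by
            by_cases hU : (0 : ℝ) ∈ U <;> by_cases hV : (0 : ℝ) ∈ V <;> simp [hU, hV]
          map_top' := by simp
          map_sSup' := fun S => by
            simp only [Opens.mem_sSup, sSup_image, iSup_exists, iSup_and] }
      pt_comp := by
        ext V
        change (FramePoint.pt : FrameHom L Prop) (⨆ _ : (0 : ℝ) ∈ V, (⊤ : L)) ↔ (0 : ℝ) ∈ V
        by_cases hV : (0 : ℝ) ∈ V
        · simp [hV]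
        · simp [hV] }

/-- The order of `ℛ₀ L`: `f ≤ g` iff `f (r, ∞) ≤ g (r, ∞)` for all real `r`. -/
instance : LE (RZero L) where
  le f g := ∀ r : ℝ, f.hom ⟨Set.Ioi r, isOpen_Ioi⟩ ≤ g.hom ⟨Set.Ioi r, isOpen_Ioi⟩

/-- Scalar multiplication, induced by the function `x ↦ r * x`. -/
noncomputable instance : SMul ℝ (RZero L) where
  smul r f := induced ⟨fun x => r * x, by fun_prop⟩ (mul_zero r) f

/-- The truncation, induced by the function `x ↦ min x 1`. (Only its values on the elements
`f ≥ 0` matter.) -/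
noncomputable def trunc (f : RZero L) : RZero L :=
  induced ⟨fun x => min x 1, by fun_prop⟩ (min_eq_left zero_le_one) f

/-- The `n`-th truncation `f ∧ n`, that is, `n` times the truncation of `f / n`. -/
noncomputable def nthTrunc (f : RZero L) (n : ℕ) : RZero L :=
  (n : ℝ) • trunc ((n : ℝ)⁻¹ • f)

end RZero

/-- An element `u` of a frame is dense if only the bottom element is disjoint from it. -/
def IsDenseElement {M : Type*} [Order.Frame M] (u : M) : Prop :=
  ∀ x : M, x ⊓ u = ⊥ → x = ⊥

/-- `𝒟₀ M`: the pointed frame homomorphisms from the pointed frame of the extended reals to `M`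
which send `(-∞, ∞)` to a dense element. -/
def DZero (M : Type*) [Order.Frame M] [FramePoint M] : Set (PointedFrameHom (Opens EReal) M) :=
  {h' | IsDenseElement (h'.hom ⟨Set.Ioo ⊥ ⊤, isOpen_Ioo⟩)}

section Compactification

variable {M L : Type*} [Order.Frame M] [FramePoint M] [Order.Frame L] [FramePoint L]

/-- A compactification: a dense surjective pointed frame homomorphism with compact domain. -/
structure IsCompactification (q : PointedFrameHom M L) : Prop where
  compact : IsCompactElement (⊤ : M)
  dense : ∀ x : M, q.hom x = ⊥ → x = ⊥
  surjective : Function.Surjective q.hom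

/-- `ℰ₀ q`: the `h ∈ ℛ₀ L` for which there is `h' ∈ 𝒟₀ M` with `q ∘ h' = h ∘ p`. -/
def EZero (q : PointedFrameHom M L) : Set (RZero L) :=
  {h | ∃ h' ∈ DZero M, q.comp h' = h.comp inclReal}

end Compactification

/-! Given an extension `h'` of `h`, compose it with the preimage map of `x ↦ max 0 (min x n)`, a
continuous map `[-∞, ∞] → ℝ`. Since `h ≥ 0` ignores the negative reals, the result lifts `h ∧ n`.

Conversely, `q` is dense and `ℝ` is regular, so lifts along `q` are unique. Hence the lift of a
lower truncation is the truncation of any higher lift (`lift_apply`). These compatible lifts are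
glued: `U` goes to the join of all `g n (V ∩ ℝ)` such that `min x (n + 1) ∈ V` forces `x ∈ U`.
Compatibility gives finite meets (`glue_inf`). Joins (`glue_sSup`) need care only at `+∞`. The glued
map lies over `h` (`apply_glue`), from which its point and the density condition follow. -/

/-- A frame homomorphism on the open sets of a regular space is determined by its composite with
a dense frame homomorphism: one inequality. -/
theorem FrameHom.opens_le_of_dense_comp {X M L : Type*} [TopologicalSpace X] [RegularSpace X]
    [Order.Frame M] [Order.Frame L] (q : FrameHom M L) (hq : ∀ x : M, q x = ⊥ → x = ⊥)
    (f g : FrameHom (Opens X) M) (hfg : ∀ U, q (f U) = q (g U)) (U : Opens X) : f U ≤ g U := by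
  have hU : U ≤ sSup {V : Opens X | closure (V : Set X) ⊆ U} := by
    intro x hx
    obtain ⟨t, ht, htc, htU⟩ := exists_mem_nhds_isClosed_subset (U.isOpen.mem_nhds hx)
    refine Opens.mem_sSup.2 ⟨⟨interior t, isOpen_interior⟩, ?_, mem_interior_iff_mem_nhds.2 ht⟩
    exact (closure_minimal interior_subset htc).trans htU
  refine (OrderHomClass.mono f hU).trans ?_
  rw [map_sSup]
  refine sSup_le ?_
  rintro _ ⟨V, hV, rfl⟩
  let W : Opens X := ⟨(closure (V : Set X))ᶜ, isClosed_closure.isOpen_compl⟩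
  have hVW : V ⊓ W = ⊥ := by
    ext x
    simp only [Opens.coe_inf, Set.mem_inter_iff, Opens.coe_bot, Set.mem_empty_iff_false,
      iff_false, not_and]
    exact fun hx hxW => hxW (subset_closure hx)
  have hUW : U ⊔ W = ⊤ := by
    ext x
    simp only [Opens.coe_sup, Set.mem_union, Opens.coe_top, Set.mem_univ, iff_true]
    by_cases hx : x ∈ closure (V : Set X)
    · exact Or.inl (hV hx)
    · exact Or.inr hx
  -- Density of `q` reflects disjointness, and `f`, `g` agree after `q`.
  have hdisj : f V ⊓ g W = ⊥ := by
    apply hq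
    rw [map_inf, ← hfg W, ← map_inf, ← map_inf, hVW, map_bot, map_bot]
  calc f V = f V ⊓ (g U ⊔ g W) := by rw [← map_sup, hUW, map_top, inf_top_eq]
    _ = f V ⊓ g U := by rw [inf_sup_left, hdisj, sup_bot_eq]
    _ ≤ g U := inf_le_right

theorem FrameHom.opens_eq_of_dense_comp {X M L : Type*} [TopologicalSpace X] [RegularSpace X]
    [Order.Frame M] [Order.Frame L] (q : FrameHom M L) (hq : ∀ x : M, q x = ⊥ → x = ⊥)
    (f g : FrameHom (Opens X) M) (hfg : ∀ U, q (f U) = q (g U)) : f = g :=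
  FrameHom.ext fun U => le_antisymm (opens_le_of_dense_comp q hq f g hfg U)
    (opens_le_of_dense_comp q hq g f (fun V => (hfg V).symm) U)

/-! ### Truncations and nonnegative elements -/

namespace RZero

/-- The map `x ↦ min x c` on the reals. -/
def minReal (c : ℝ) : C(ℝ, ℝ) := ⟨fun x => min x c, by fun_prop⟩

/-- The map `x ↦ min x c` on the extended reals. -/
noncomputable def minEReal (c : ℝ) : C(EReal, EReal) := ⟨fun x => min x c, by fun_prop⟩

variable {L : Type*} [Order.Frame L] [FramePoint L]

theorem nthTrunc_apply (h : RZero L) {n : ℕ} (hn : 1 ≤ n) (V : Opens ℝ) :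
    (h.nthTrunc n).hom V = h.hom (Opens.comap (minReal n) V) := by
  change h.hom _ = h.hom _
  congr 1
  ext x
  change (n : ℝ) * min ((n : ℝ)⁻¹ * x) 1 ∈ V ↔ min x (n : ℝ) ∈ V
  have hn' : (0 : ℝ) < n := by exact_mod_cast hn
  rw [mul_min_of_nonneg _ _ hn'.le, mul_inv_cancel_left₀ hn'.ne', mul_one]

/-- For `r < 0`, `h ≥ 0` sends `(r, ∞)` to `⊤`, hence the disjoint `(-∞, r)` to `⊥`; these rays
exhaust `(-∞, 0)`. -/
theorem apply_Iio_zero_of_nonneg {h : RZero L} (hh : 0 ≤ h) :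
    h.hom ⟨Set.Iio 0, isOpen_Iio⟩ = ⊥ := by
  have hU : (⟨Set.Iio 0, isOpen_Iio⟩ : Opens ℝ) ≤
      ⨆ r : Set.Iio (0 : ℝ), ⟨Set.Iio (r : ℝ), isOpen_Iio⟩ := by
    intro x hx
    obtain ⟨r, hxr, hr⟩ := exists_between (show x < 0 from hx)
    exact Opens.mem_iSup.2 ⟨⟨r, hr⟩, hxr⟩
  refine le_bot_iff.1 ((OrderHomClass.mono h.hom hU).trans ?_)
  rw [map_iSup]
  refine iSup_le fun r => ?_
  have htop : h.hom ⟨Set.Ioi (r : ℝ), isOpen_Ioi⟩ = ⊤ := by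
    refine top_le_iff.1 (le_trans ?_ (hh r))
    exact le_iSup (fun _ : (0 : ℝ) ∈ (⟨Set.Ioi (r : ℝ), isOpen_Ioi⟩ : Opens ℝ) => (⊤ : L)) r.2
  rw [← inf_top_eq (h.hom _), ← htop, ← map_inf, ← map_bot h.hom]
  refine OrderHomClass.mono h.hom fun x hx => ?_
  exact (lt_asymm (show x < r from hx.1) hx.2).elim

theorem apply_le_of_nonneg {h : RZero L} (hh : 0 ≤ h) {U V : Opens ℝ}
    (hUV : ∀ x, 0 ≤ x → x ∈ U → x ∈ V) : h.hom U ≤ h.hom V := by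
  have hle : U ≤ V ⊔ ⟨Set.Iio 0, isOpen_Iio⟩ := by
    intro x hx
    rcases lt_or_ge x 0 with h0 | h0
    · exact Or.inr h0
    · exact Or.inl (hUV x h0 hx)
  refine (OrderHomClass.mono h.hom hle).trans ?_
  rw [map_sup, apply_Iio_zero_of_nonneg hh, sup_bot_eq]

theorem apply_congr_of_nonneg {h : RZero L} (hh : 0 ≤ h) {U V : Opens ℝ}
    (hUV : ∀ x, 0 ≤ x → (x ∈ U ↔ x ∈ V)) : h.hom U = h.hom V :=
  le_antisymm (apply_le_of_nonneg hh fun x hx => (hUV x hx).1)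
    (apply_le_of_nonneg hh fun x hx => (hUV x hx).2)

/-- The map `x ↦ max 0 (min x c)` from the extended reals to the reals. -/
noncomputable def clamp (c : ℝ) : C(EReal, ℝ) where
  toFun x := (max 0 (min x c)).toReal
  continuous_toFun := by
    refine continuous_iff_continuousAt.2 fun x => ?_
    -- `EReal.toReal` is continuous at finite points; the two bounds keep the argument finite.
    refine ContinuousAt.comp (g := EReal.toReal) ?_ (by fun_prop)
    apply EReal.tendsto_toReal
    · exact (max_lt EReal.zero_lt_top (min_lt_of_right_lt (EReal.coe_lt_top c))).ne
    · exact (lt_of_lt_of_le EReal.bot_lt_zero (le_max_left _ _)).ne'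

theorem clamp_coe (c x : ℝ) : clamp c x = max 0 (min x c) := by
  change (max 0 (min (x : EReal) c)).toReal = _
  rw [← EReal.coe_strictMono.monotone.map_min, ← EReal.coe_zero,
    ← EReal.coe_strictMono.monotone.map_max, EReal.toReal_coe]

theorem clamp_zero {c : ℝ} (hc : 0 ≤ c) : clamp c 0 = 0 := by
  rw [← EReal.coe_zero, clamp_coe, min_eq_left hc, max_self]

variable {M : Type*} [Order.Frame M] [FramePoint M]

theorem exists_nthTrunc_eq_comp {q : PointedFrameHom M L} {h : RZero L} (hh : 0 ≤ h)
    {h' : PointedFrameHom (Opens EReal) M} (hh' : q.comp h' = h.comp inclReal)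
    {n : ℕ} (hn : 1 ≤ n) : ∃ g : RZero M, h.nthTrunc n = q.comp g := by
  refine ⟨h'.comp (pointedComap (clamp n) (clamp_zero n.cast_nonneg)),
    PointedFrameHom.ext (FrameHom.ext fun V => ?_)⟩
  have key : q.hom (h'.hom (Opens.comap (clamp n) V)) =
      h.hom (inclReal.hom (Opens.comap (clamp n) V)) :=
    DFunLike.congr_fun (congrArg PointedFrameHom.hom hh') _
  refine Eq.trans ?_ key.symm
  rw [nthTrunc_apply h hn]
  refine apply_congr_of_nonneg hh fun x hx => ?_
  change min x (n : ℝ) ∈ V ↔ clamp n (x : EReal) ∈ V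
  rw [clamp_coe, max_eq_right (le_min hx n.cast_nonneg)]

/-! ### Gluing the lifts -/

/-- If the truncations of `h` lift along `q`, these lifts are compatible with truncation. -/
theorem lift_apply {q : PointedFrameHom M L} (hq : ∀ x : M, q.hom x = ⊥ → x = ⊥)
    {h : RZero L} {g : ℕ → RZero M} (hg : ∀ n, h.nthTrunc (n + 1) = q.comp (g n)) {m n : ℕ}
    (hmn : m ≤ n) (V : Opens ℝ) :
    (g m).hom V = (g n).hom (Opens.comap (minReal (m + 1 : ℕ)) V) := by
  have hqg (n : ℕ) (V : Opens ℝ) :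
      q.hom ((g n).hom V) = h.hom (Opens.comap (minReal (n + 1 : ℕ)) V) := by
    rw [← nthTrunc_apply h n.succ_pos, hg]
    rfl
  refine DFunLike.congr_fun (FrameHom.opens_eq_of_dense_comp q.hom hq (g m).hom
    ((g n).hom.comp (Opens.comap (minReal (m + 1 : ℕ)))) fun U => ?_) V
  rw [hqg]
  refine Eq.trans ?_ (hqg n _).symm
  congr 1
  ext x
  change min x ((m + 1 : ℕ) : ℝ) ∈ U ↔ min (min x ((n + 1 : ℕ) : ℝ)) ((m + 1 : ℕ) : ℝ) ∈ U
  rw [min_assoc, min_eq_right (a := ((n + 1 : ℕ) : ℝ)) (by exact_mod_cast Nat.succ_le_succ hmn)]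

/-- The value at `U` of the extension to `[-∞, ∞]` of a sequence of lifts of truncations. -/
noncomputable def glue (g : ℕ → RZero M) (U : Opens EReal) : M :=
  ⨆ (n : ℕ) (V : Opens EReal) (_ : Opens.comap (minEReal (n + 1 : ℕ)) V ≤ U),
    (g n).hom (inclReal.hom V)

theorem le_glue (g : ℕ → RZero M) {U : Opens EReal} (n : ℕ) (V : Opens EReal)
    (hV : Opens.comap (minEReal (n + 1 : ℕ)) V ≤ U) : (g n).hom (inclReal.hom V) ≤ glue g U :=
  le_iSup_of_le n (le_iSup₂_of_le V hV le_rfl)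

theorem glue_le {g : ℕ → RZero M} {U : Opens EReal} {a : M}
    (ha : ∀ (n : ℕ) (V : Opens EReal), Opens.comap (minEReal (n + 1 : ℕ)) V ≤ U →
      (g n).hom (inclReal.hom V) ≤ a) : glue g U ≤ a :=
  iSup_le fun n => iSup₂_le fun V hV => ha n V hV

theorem glue_mono (g : ℕ → RZero M) : Monotone (glue g) := fun _ _ hUU' =>
  glue_le fun n V hV => le_glue g n V (hV.trans hUU')

theorem glue_top (g : ℕ → RZero M) : glue g ⊤ = ⊤ := by
  refine top_le_iff.1 (le_trans ?_ (le_glue g 0 ⊤ le_top))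
  rw [map_top, map_top]

/-- Truncation at `n + 1` moves points only to `n + 1 ∉ V`, so the preimage of `V` is contained in
`V`. -/
theorem le_glue_of_subset_Iio (g : ℕ → RZero M) {U V : Opens EReal} (n : ℕ) (hV : V ≤ U)
    (hVn : ∀ x ∈ V, x < ((n + 1 : ℕ) : ℝ)) : (g n).hom (inclReal.hom V) ≤ glue g U := by
  refine le_glue g n V fun x hx => ?_
  have hx' : min x (((n + 1 : ℕ) : ℝ) : EReal) ∈ V := hx
  have hlt : x < (((n + 1 : ℕ) : ℝ) : EReal) := by
    by_contra hge
    rw [min_eq_right (not_lt.1 hge)] at hx'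
    exact lt_irrefl _ (hVn _ hx')
  rw [min_eq_left hlt.le] at hx'
  exact hV hx'

theorem apply_inclReal_of_le {g : ℕ → RZero M}
    (hg : ∀ ⦃m n : ℕ⦄, m ≤ n → ∀ V : Opens ℝ,
      (g m).hom V = (g n).hom (Opens.comap (minReal (m + 1 : ℕ)) V))
    {m n : ℕ} (hmn : m ≤ n) (V : Opens EReal) :
    (g m).hom (inclReal.hom V) =
      (g n).hom (inclReal.hom (Opens.comap (minEReal (m + 1 : ℕ)) V)) := by
  rw [hg hmn]
  congr 1

theorem comap_minEReal_comap {m n : ℕ} (hmn : m ≤ n) (V : Opens EReal) :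
    Opens.comap (minEReal (n + 1 : ℕ)) (Opens.comap (minEReal (m + 1 : ℕ)) V) =
      Opens.comap (minEReal (m + 1 : ℕ)) V := by
  ext x
  change min (min x (((n + 1 : ℕ) : ℝ) : EReal)) (((m + 1 : ℕ) : ℝ) : EReal) ∈ V ↔
    min x (((m + 1 : ℕ) : ℝ) : EReal) ∈ V
  rw [min_assoc, min_eq_right (a := (((n + 1 : ℕ) : ℝ) : EReal))
    (by exact_mod_cast Nat.succ_le_succ hmn)]

theorem glue_inf {g : ℕ → RZero M}
    (hg : ∀ ⦃m n : ℕ⦄, m ≤ n → ∀ V : Opens ℝ,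
      (g m).hom V = (g n).hom (Opens.comap (minReal (m + 1 : ℕ)) V))
    (U U' : Opens EReal) : glue g (U ⊓ U') = glue g U ⊓ glue g U' := by
  refine le_antisymm (le_inf (glue_mono g inf_le_left) (glue_mono g inf_le_right)) ?_
  simp only [glue, iSup_inf_eq, inf_iSup_eq]
  refine iSup_le fun n => iSup₂_le fun V' hV' => iSup_le fun m => iSup₂_le fun V hV => ?_
  -- Both terms are moved to the common level `max m n`, where a single homomorphism preserves the
  -- meet.
  rw [apply_inclReal_of_le hg (le_max_left m n) V, apply_inclReal_of_le hg (le_max_right m n) V',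
    ← map_inf, ← map_inf]
  refine le_glue g (max m n) _ ?_
  rw [map_inf, comap_minEReal_comap (le_max_left m n), comap_minEReal_comap (le_max_right m n)]
  exact inf_le_inf hV hV'

theorem le_sSup_glue_of_subset_Iio (g : ℕ → RZero M) {S : Set (Opens EReal)} {V : Opens EReal}
    (n : ℕ) (hV : V ≤ sSup S) (hVn : ∀ x ∈ V, x < ((n + 1 : ℕ) : ℝ)) :
    (g n).hom (inclReal.hom V) ≤ sSup (glue g '' S) := by
  rw [← inf_eq_left.2 hV, inf_sSup_eq, map_iSup, map_iSup]
  refine iSup_le fun U => ?_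
  rw [map_iSup, map_iSup]
  refine iSup_le fun hU => ?_
  exact (le_glue_of_subset_Iio g n inf_le_right fun x hx => hVn x hx.1).trans
    (le_sSup ⟨U, hU, rfl⟩)

theorem glue_sSup {g : ℕ → RZero M}
    (hg : ∀ ⦃m n : ℕ⦄, m ≤ n → ∀ V : Opens ℝ,
      (g m).hom V = (g n).hom (Opens.comap (minReal (m + 1 : ℕ)) V))
    (S : Set (Opens EReal)) : glue g (sSup S) = sSup (glue g '' S) := by
  refine le_antisymm (glue_le fun n V hV => ?_) (sSup_le ?_)
  -- If `n + 1 ∈ V`, the preimage of `V` contains `+∞`, so one `U ∈ S` contains some `(c, ∞]`; only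
  -- the part below a finite level needs the rest of the cover.
  · by_cases hn : (((n + 1 : ℕ) : ℝ) : EReal) ∈ V
    · have htop : (⊤ : EReal) ∈ sSup S := by
        refine hV ?_
        change min ⊤ (((n + 1 : ℕ) : ℝ) : EReal) ∈ V
        rwa [min_eq_right le_top]
      obtain ⟨U, hU, htU⟩ := Opens.mem_sSup.1 htop
      obtain ⟨c, hc⟩ := EReal.mem_nhds_top_iff.1 (U.isOpen.mem_nhds htU)
      obtain ⟨k, hk⟩ := exists_nat_ge c
      let m := max n k
      let A : Opens EReal := ⟨Set.Iio (((m + 1 : ℕ) : ℝ) : EReal), isOpen_Iio⟩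
      -- Starting at `m` rather than `m + 1` makes `A` and `B` cover; the preimage of `B` under
      -- truncation at `m + 1` is still `(m, ∞]`, inside `U` as `m ≥ c`.
      let B : Opens EReal := ⟨Set.Ioi ((m : ℝ) : EReal), isOpen_Ioi⟩
      have hAB : A ⊔ B = ⊤ := by
        ext x
        simp only [Opens.coe_sup, Set.mem_union, Opens.coe_top, Set.mem_univ, iff_true]
        refine (lt_or_ge x (((m + 1 : ℕ) : ℝ) : EReal)).imp id fun hx => ?_
        exact lt_of_lt_of_le (by exact_mod_cast m.lt_succ_self) hx
      rw [apply_inclReal_of_le hg (le_max_left n k) V]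
      set W := Opens.comap (minEReal (n + 1 : ℕ)) V
      have hW : W ≤ (W ⊓ A) ⊔ B := by
        rw [sup_inf_right, hAB, inf_top_eq]
        exact le_sup_left
      refine (OrderHomClass.mono (g m).hom (OrderHomClass.mono inclReal.hom hW)).trans ?_
      rw [map_sup, map_sup]
      refine sup_le ?_ ?_
      · exact le_sSup_glue_of_subset_Iio g m (inf_le_left.trans hV) fun x hx => hx.2
      · refine (le_glue g (U := U) m B fun x hx => hc ?_).trans (le_sSup ⟨U, hU, rfl⟩)
        have hx' : ((m : ℝ) : EReal) < min x (((m + 1 : ℕ) : ℝ) : EReal) := hx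
        refine lt_of_le_of_lt ?_ (lt_min_iff.1 hx').1
        exact_mod_cast hk.trans (by exact_mod_cast le_max_right n k)
    -- Equal indices let `V` be replaced by its own preimage, which lies in `sSup S` and below `n +
    -- 1`.
    · rw [apply_inclReal_of_le hg le_rfl V]
      refine le_sSup_glue_of_subset_Iio g n hV fun x hx => ?_
      have hx' : min x (((n + 1 : ℕ) : ℝ) : EReal) ∈ V := hx
      by_contra hge
      rw [min_eq_right (not_lt.1 hge)] at hx'
      exact hn hx'
  · rintro _ ⟨U, hU, rfl⟩
    exact glue_mono g (le_sSup hU)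

/-- The extension to `[-∞, ∞]` of a compatible sequence of lifts of truncations. -/
noncomputable def glueHom (g : ℕ → RZero M)
    (hg : ∀ ⦃m n : ℕ⦄, m ≤ n → ∀ V : Opens ℝ,
      (g m).hom V = (g n).hom (Opens.comap (minReal (m + 1 : ℕ)) V)) :
    FrameHom (Opens EReal) M where
  toFun := glue g
  map_inf' := glue_inf hg
  map_top' := glue_top g
  map_sSup' := glue_sSup hg

/-! ### The glued map extends `h` -/

theorem apply_glue {q : PointedFrameHom M L} {h : RZero L} {g : ℕ → RZero M}
    (hg : ∀ n, h.nthTrunc (n + 1) = q.comp (g n)) (U : Opens EReal) :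
    q.hom (glue g U) = h.hom (inclReal.hom U) := by
  have hqg (n : ℕ) (V : Opens ℝ) :
      q.hom ((g n).hom V) = h.hom (Opens.comap (minReal (n + 1 : ℕ)) V) := by
    rw [← nthTrunc_apply h n.succ_pos, hg]
    rfl
  apply le_antisymm
  · simp only [glue, map_iSup]
    refine iSup_le fun n => iSup₂_le fun V hV => ?_
    rw [hqg]
    refine OrderHomClass.mono h.hom fun x hx => hV (x := (x : EReal)) ?_
    change min (x : EReal) (((n + 1 : ℕ) : ℝ) : EReal) ∈ V
    rw [← EReal.coe_strictMono.monotone.map_min]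
    exact hx
  -- The rays below `n + 1` exhaust `ℝ`, and truncation at `n + 1` is the identity on them.
  · let A (n : ℕ) : Opens EReal := ⟨Set.Iio (((n + 1 : ℕ) : ℝ) : EReal), isOpen_Iio⟩
    have hU : inclReal.hom U ≤ ⨆ n, inclReal.hom (U ⊓ A n) := by
      intro x hx
      obtain ⟨n, hn⟩ := exists_nat_gt x
      refine Opens.mem_iSup.2 ⟨n, hx, ?_⟩
      change (x : EReal) < (((n + 1 : ℕ) : ℝ) : EReal)
      exact_mod_cast hn.trans (by exact_mod_cast n.lt_succ_self)
    refine (OrderHomClass.mono h.hom hU).trans ?_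
    rw [map_iSup]
    refine iSup_le fun n => ?_
    refine le_trans ?_ (OrderHomClass.mono q.hom
      (le_glue_of_subset_Iio g n (inf_le_left : U ⊓ A n ≤ U) fun x hx => hx.2))
    rw [hqg]
    refine OrderHomClass.mono h.hom fun x hx => ?_
    have hlt : (x : EReal) < (((n + 1 : ℕ) : ℝ) : EReal) := hx.2
    change ((min x ((n + 1 : ℕ) : ℝ) : ℝ) : EReal) ∈ U ⊓ A n
    rw [min_eq_left (by exact_mod_cast hlt.le)]
    exact hx

theorem mem_EZero_of_nthTrunc {q : PointedFrameHom M L} (hq : ∀ x : M, q.hom x = ⊥ → x = ⊥)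
    {h : RZero L} {g : ℕ → RZero M} (hg : ∀ n, h.nthTrunc (n + 1) = q.comp (g n)) :
    h ∈ EZero q := by
  let k : FrameHom (Opens EReal) M := glueHom g fun _ _ hmn => lift_apply hq hg hmn
  have hk : q.hom.comp k = h.hom.comp inclReal.hom := FrameHom.ext (apply_glue hg)
  refine ⟨⟨k, ?_⟩, fun x hx => hq x ?_, PointedFrameHom.ext hk⟩
  · rw [← q.pt_comp, FrameHom.comp_assoc, hk]
    exact (h.comp inclReal).pt_comp
  -- Over `L` the finite part becomes `h(ℝ) = ⊤`, so anything disjoint from it in `M` is killed by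
  -- `q`.
  · have htop : q.hom (k ⟨Set.Ioo ⊥ ⊤, isOpen_Ioo⟩) = ⊤ := by
      refine (DFunLike.congr_fun hk _).trans ?_
      rw [← map_top h.hom]
      change h.hom _ = h.hom _
      congr 1
      ext x
      exact ⟨fun _ => trivial, fun _ => ⟨EReal.bot_lt_coe x, EReal.coe_lt_top x⟩⟩
    rw [← inf_top_eq (q.hom x), ← htop, ← map_inf]
    exact (congrArg q.hom hx).trans (map_bot q.hom)

end RZero

theorem proposition1 {M L : Type*} [Order.Frame M] [FramePoint M] [Order.Frame L] [FramePoint L]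
    (q : PointedFrameHom M L) (hq : IsCompactification q) (h : RZero L) (hh : 0 ≤ h) :
    h ∈ EZero q ↔
      ∀ n : ℕ, 1 ≤ n → ∃ g : RZero M, h.nthTrunc n = q.comp g := by
  constructor
  · rintro ⟨h', -, hh'⟩ n hn
    exact RZero.exists_nthTrunc_eq_comp hh hh' hn
  · intro H
    choose g hg using fun n : ℕ => H (n + 1) n.succ_pos
    exact RZero.mem_EZero_of_nthTrunc hq.dense hg
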